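/- Let $\mathbb K$ be $\mathbb R$ or $\mathbb C$, and let $X$ be either $\ell_p=\ell_p(\mathbb Z_+)$ with $1\le p<\infty$ or $c_0=c_0(\mathbb Z_+)$, over $\mathbb K$, with canonical basis $(e_n)_{n\ge 0}$. Let $(w_n)_{n\ge 1}$ be a bounded sequence of non-zero elements of $\mathbb K$, and let $T$ be the backward weighted shift on $X$ with weights $w_n$, that is, the bounded linear operator on $X$ with $Te_0=0$ and $Te_n=w_ne_{n-1}$ for $n\ge 1$. Assume that $$\liminf_{n\to\infty}\Bigl(n!\prod_{j=1}^n|w_j|\Bigr)^{1/n}>0,$$ where the value $+\infty$ of the lower limit is allowed. Then $I+T$ satisfies the Kitai Criterion: there exist dense subsets $E$ and $F$ of $X$ and a map $S:F\to F$ such that $(I+T)Sy=y$ and $S^ky\to 0$ as $k\to\infty$ for every $y\in F$, and $(I+T)^kx\to 0$ as $k\to\infty$ for every $x\in E$. -/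

import Mathlib

open Filter Topology
open scoped ENNReal ZeroAtInfty

/-- The Kitai Criterion for a bounded linear operator `T`: there are dense subsets `E` and `F` of
`X` and a (not necessarily linear or continuous) map `S : F → F` with `T (S y) = y` and `S ^ k y → 0`
for `y ∈ F`, and `T ^ k x → 0` for `x ∈ E`. -/
def KitaiCriterion {𝕜 X : Type*} [RCLike 𝕜] [NormedAddCommGroup X] [NormedSpace 𝕜 X]
    (T : X →L[𝕜] X) : Prop :=
  ∃ (E F : Set X) (S : F → F), Dense E ∧ Dense F ∧
    (∀ y : F, T (S y : X) = y) ∧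
    (∀ y : F, Tendsto (fun k : ℕ => ((S^[k] y : F) : X)) atTop (𝓝 0)) ∧
    (∀ x ∈ E, Tendsto (fun k : ℕ => (T ^ k) x) atTop (𝓝 0))

/-- `T` is the backward weighted shift with weights `w 1, w 2, …` (a bounded sequence of nonzero
scalars) with respect to the canonical basis `e 0, e 1, …`. The value `w 0` is not used. -/
structure IsBackwardWeightedShift {𝕜 X : Type*} [RCLike 𝕜] [NormedAddCommGroup X]
    [NormedSpace 𝕜 X] (e : ℕ → X) (w : ℕ → 𝕜) (T : X →L[𝕜] X) : Prop where
  weight_ne_zero : ∀ n, 1 ≤ n → w n ≠ 0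
  weight_bounded : ∃ C : ℝ, ∀ n, 1 ≤ n → ‖w n‖ ≤ C
  map_zero : T (e 0) = 0
  map_basis : ∀ n, 1 ≤ n → T (e n) = w n • e (n - 1)

/-- The `n`-th canonical basis vector of `ℓ_p`, indexed by the non-negative integers. -/
noncomputable def lpBasis (𝕜 : Type*) [RCLike 𝕜] (p : ℝ≥0∞) (n : ℕ) : lp (fun _ : ℕ => 𝕜) p :=
  lp.single p n (1 : 𝕜)

/-- The `n`-th canonical basis vector of `c_0`, which is realised as the space `C₀(ℕ, 𝕜)` of
functions on the discrete space `ℕ` tending to zero at infinity, with the sup norm. -/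
noncomputable def c0Basis (𝕜 : Type*) [RCLike 𝕜] (n : ℕ) : C₀(ℕ, 𝕜) where
  toFun := Pi.single n (1 : 𝕜)
  continuous_toFun := continuous_of_discreteTopology
  zero_at_infty' := by
    rw [cocompact_eq_cofinite, Nat.cofinite_eq_atTop]
    refine tendsto_const_nhds.congr' ?_
    filter_upwards [eventually_gt_atTop n] with m hm
    simp [hm.ne']

/-! Put f_n = e_n / (w_1 ⋯ w_n), so that T f_0 = 0 and T f_{n+1} = f_n; the hypothesis on the
weights says ‖f_n‖ ≤ K n! C^n. Let V be the Volterra operator. Since V^{n+1} g (c) is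
O(c^{n+1}/(n+1)!), the series Σ V^{n+1} g (c) f_n converges for small c > 0, and g ↦ Σ V^{n+1} g (c)
f_n intertwines V with T. Inserting signs (-1)^n intertwines -V with T. Thus orbits of I + T can be
read off from I - V and I + V applied to the constant 1.

The forward orbit (I - V)^k 1 consists of the Laguerre polynomials L_k, and a backward orbit of 1
under I + V is 1, e^{-t} L_0, e^{-t} L_1, …. An energy estimate (`laguerre_energy_le`) gives |L_k| ≤
1 on [0, 1/2] and L_k - L_{k+1} → 0 there, so every V^{n+1} of either orbit tends to 0 pointwise,
and dominated convergence carries this over to X.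

The starting vectors Σ (±1)^n c^{n+1}/(n+1)! f_n form a power series in c whose coefficients are
nonzero multiples of the f_n, so they span densely (`dense_of_mem_series`). The right inverse S is
single-valued because I + T is injective on vectors whose f_n-coordinates tend to 0. -/

/-! ### The Volterra operator -/

/-- The Volterra operator `f ↦ ∫₀ᵗ f` on continuous functions. -/
noncomputable def volterra : C(ℝ, ℝ) →ₗ[ℝ] C(ℝ, ℝ) where
  toFun f := ⟨fun t => ∫ s in (0 : ℝ)..t, f s,
    intervalIntegral.continuous_primitive (fun a b => f.continuous.intervalIntegrable a b) 0⟩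
  map_add' f g := by
    ext t
    exact intervalIntegral.integral_add (f.continuous.intervalIntegrable _ _)
      (g.continuous.intervalIntegrable _ _)
  map_smul' c f := by
    ext t
    exact intervalIntegral.integral_const_mul c f

theorem volterra_apply (f : C(ℝ, ℝ)) (t : ℝ) : volterra f t = ∫ s in (0 : ℝ)..t, f s := rfl

theorem volterra_zero (f : C(ℝ, ℝ)) : volterra f 0 = 0 := by simp [volterra_apply]

theorem hasDerivAt_volterra (f : C(ℝ, ℝ)) (t : ℝ) : HasDerivAt (volterra f) (f t) t :=
  intervalIntegral.integral_hasDerivAt_right (f.continuous.intervalIntegrable _ _)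
    f.continuous.stronglyMeasurable.stronglyMeasurableAtFilter f.continuous.continuousAt

theorem abs_volterra_pow_le {f : C(ℝ, ℝ)} {d : ℝ} (hf : ∀ t ∈ Set.Icc 0 d, |f t| ≤ 1) (n : ℕ) :
    ∀ t ∈ Set.Icc 0 d, |(volterra ^ n) f t| ≤ t ^ n / n.factorial := by
  induction n with
  | zero => simpa using hf
  | succ n ih =>
    intro t ht
    have h1 : ‖∫ s in (0 : ℝ)..t, (volterra ^ n) f s‖ ≤ ∫ s in (0 : ℝ)..t, s ^ n / n.factorial := by
      refine intervalIntegral.norm_integral_le_of_norm_le ht.1 ?_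
        ((by fun_prop : Continuous fun s : ℝ => s ^ n / n.factorial).intervalIntegrable _ _)
      refine Eventually.of_forall fun s hs => ?_
      exact ih s ⟨hs.1.le, hs.2.trans ht.2⟩
    rw [pow_succ', Module.End.mul_apply, volterra_apply]
    refine h1.trans (le_of_eq ?_)
    rw [intervalIntegral.integral_div, integral_pow, Nat.factorial_succ]
    push_cast
    have : ((n : ℝ) + 1) ≠ 0 := by positivity
    field_simp
    simp

theorem volterra_pow_one (n : ℕ) (t : ℝ) : (volterra ^ n) 1 t = t ^ n / n.factorial := by
  induction n generalizing t with
  | zero => simp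
  | succ n ih =>
    rw [pow_succ', Module.End.mul_apply, volterra_apply]
    simp only [ih]
    rw [intervalIntegral.integral_div, integral_pow, Nat.factorial_succ]
    push_cast
    have : ((n : ℝ) + 1) ≠ 0 := by positivity
    field_simp
    simp

/-! ### Laguerre polynomials: recurrence and bounds on [0, 1/2] -/

/-- The Laguerre polynomials, as the orbit of `1` under `I - V` with `V` the Volterra operator. -/
noncomputable def laguerre (k : ℕ) : C(ℝ, ℝ) := ((1 - volterra) ^ k) 1

/-- The derivatives of the Laguerre polynomials. -/
noncomputable def laguerreDeriv : ℕ → ℝ → ℝ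
  | 0, _ => 0
  | k + 1, t => laguerreDeriv k t - laguerre k t

theorem laguerre_zero : laguerre 0 = 1 := rfl

theorem laguerre_succ (k : ℕ) : laguerre (k + 1) = laguerre k - volterra (laguerre k) := by
  simp [laguerre, pow_succ']

theorem laguerre_apply_zero (k : ℕ) : laguerre k 0 = 1 := by
  induction k with
  | zero => simp [laguerre_zero]
  | succ k ih => simp [laguerre_succ, ih, volterra_zero]

theorem hasDerivAt_laguerre (k : ℕ) (t : ℝ) :
    HasDerivAt (laguerre k) (laguerreDeriv k t) t := by
  induction k with
  | zero => exact hasDerivAt_const t (1 : ℝ)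
  | succ k ih =>
    rw [laguerre_succ]
    exact ih.sub (hasDerivAt_volterra _ t)

theorem differentiable_laguerreDeriv (k : ℕ) : Differentiable ℝ (laguerreDeriv k) := by
  induction k with
  | zero => exact differentiable_const (0 : ℝ)
  | succ k ih => exact ih.sub fun t => (hasDerivAt_laguerre k t).differentiableAt

theorem eq_zero_of_hasDerivAt_zero {g : ℝ → ℝ} (hg : ∀ s, HasDerivAt g 0 s) (h0 : g 0 = 0)
    (t : ℝ) : g t = 0 := by
  rw [is_const_of_deriv_eq_zero (fun s => (hg s).differentiableAt) (fun s => (hg s).deriv) t 0, h0]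

theorem mul_laguerreDeriv_succ (k : ℕ) (t : ℝ) :
    t * laguerreDeriv (k + 1) t = (k + 1) * (laguerre (k + 1) t - laguerre k t) := by
  induction k generalizing t with
  | zero => simp [laguerreDeriv, laguerre_succ, laguerre_zero, volterra_apply]
  | succ k ih =>
    refine sub_eq_zero.1 (eq_zero_of_hasDerivAt_zero (g := fun s => s * laguerreDeriv (k + 1 + 1) s -
      ((k + 1 : ℕ) + 1) * (laguerre (k + 1 + 1) s - laguerre (k + 1) s)) (fun s => ?_) ?_ t)
    · have h1 : (fun s => s * laguerreDeriv (k + 1 + 1) s) = fun s =>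
          (k + 1) * (laguerre (k + 1) s - laguerre k s) - s * laguerre (k + 1) s := by
        ext s
        rw [← ih s, laguerreDeriv]
        ring
      have hA := hasDerivAt_laguerre k s
      have hB := hasDerivAt_laguerre (k + 1) s
      have hC := hasDerivAt_laguerre (k + 1 + 1) s
      have h2 := ((((hB.sub hA).const_mul ((k : ℝ) + 1)).sub ((hasDerivAt_id s).mul hB))).sub
        ((hC.sub hB).const_mul (((k + 1 : ℕ) : ℝ) + 1))
      have h3 := congrFun h1
      refine (h2.congr_deriv ?_).congr_of_eventuallyEq (Eventually.of_forall fun r => ?_)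
      · have := ih s
        simp only [laguerreDeriv, id] at this ⊢
        push_cast
        linarith
      · have := h3 r
        simp [this]
    · simp [laguerre_apply_zero]

/-- By the Laguerre equation t y'' + (1 - t) y' + (k + 1) y = 0, the left side has derivative -(1 -
2t) y'², so it decreases on [0, 1/2] from its value k + 1 at 0. -/
theorem laguerre_energy_le (k : ℕ) {t : ℝ} (ht : t ∈ Set.Icc (0 : ℝ) (1 / 2)) :
    (k + 1) * laguerre (k + 1) t ^ 2 + t * laguerreDeriv (k + 1) t ^ 2 ≤ k + 1 := by
  set g : ℝ → ℝ := fun t => (k + 1) * laguerre (k + 1) t ^ 2 + t * laguerreDeriv (k + 1) t ^ 2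
  have hg : ∀ s, HasDerivAt g (-(1 - 2 * s) * laguerreDeriv (k + 1) s ^ 2) s := fun s => by
    have hA := hasDerivAt_laguerre k s
    have hB := hasDerivAt_laguerre (k + 1) s
    have hP := (differentiable_laguerreDeriv (k + 1) s).hasDerivAt
    -- The differentiated recurrence; together with `h5` and `h6` it amounts to the Laguerre
    -- equation.
    have h1 : laguerreDeriv (k + 1) s + s * deriv (laguerreDeriv (k + 1)) s =
        (k + 1) * (laguerreDeriv (k + 1) s - laguerreDeriv k s) := by
      have h2 := (hasDerivAt_id s).mul hP
      have h3 := (hB.sub hA).const_mul ((k : ℝ) + 1)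
      have h4 := h2.unique (h3.congr_of_eventuallyEq
        (Eventually.of_forall fun r => mul_laguerreDeriv_succ k r))
      simpa using h4
    refine (((hB.pow 2).const_mul ((k : ℝ) + 1)).add
      ((hasDerivAt_id s).mul (hP.pow 2))).congr_deriv ?_
    have h5 := mul_laguerreDeriv_succ k s
    have h6 : laguerreDeriv (k + 1) s = laguerreDeriv k s - laguerre k s := rfl
    simp only [id]
    norm_num
    linear_combination (2 * laguerreDeriv (k + 1) s) * (h1 - h5 + (k + 1) * h6)
  have hanti : AntitoneOn g (Set.Icc 0 (1 / 2)) := by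
    refine antitoneOn_of_deriv_nonpos (convex_Icc _ _)
      (fun s _ => (hg s).continuousAt.continuousWithinAt)
      (fun s _ => (hg s).differentiableAt.differentiableWithinAt) fun s hs => ?_
    rw [interior_Icc] at hs
    rw [(hg s).deriv]
    have : 0 ≤ 1 - 2 * s := by linarith [hs.2]
    nlinarith [mul_nonneg this (sq_nonneg (laguerreDeriv (k + 1) s))]
  have := hanti (Set.left_mem_Icc.2 (by norm_num)) ht ht.1
  simpa [g, laguerre_apply_zero] using this

theorem abs_laguerre_le_one (k : ℕ) {t : ℝ} (ht : t ∈ Set.Icc (0 : ℝ) (1 / 2)) :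
    |laguerre k t| ≤ 1 := by
  cases k with
  | zero => simp [laguerre_zero]
  | succ k =>
    have h := laguerre_energy_le k ht
    have h1 : 0 ≤ t * laguerreDeriv (k + 1) t ^ 2 := mul_nonneg ht.1 (sq_nonneg _)
    have h2 : (0 : ℝ) < k + 1 := by positivity
    rw [← sq_le_one_iff_abs_le_one]
    by_contra! h3
    nlinarith

theorem tendsto_laguerre_sub {t : ℝ} (ht : t ∈ Set.Icc (0 : ℝ) (1 / 2)) :
    Tendsto (fun k => laguerre k t - laguerre (k + 1) t) atTop (𝓝 0) := by
  have hsq : ∀ k : ℕ, (laguerre k t - laguerre (k + 1) t) ^ 2 ≤ 1 / ((k : ℝ) + 1) := fun k => by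
    have h := laguerre_energy_le k ht
    have h2 : (0 : ℝ) < k + 1 := by positivity
    have h1 : 0 ≤ ((k : ℝ) + 1) * laguerre (k + 1) t ^ 2 := by positivity
    have h3 : t * (t * laguerreDeriv (k + 1) t ^ 2) ≤ 1 * ((k : ℝ) + 1) :=
      mul_le_mul (by linarith [ht.2]) (by linarith) (mul_nonneg ht.1 (sq_nonneg _)) zero_le_one
    -- The recurrence turns the difference into t L'_{k+1}, which the energy controls.
    have h4 : ((k : ℝ) + 1) ^ 2 * (laguerre k t - laguerre (k + 1) t) ^ 2 ≤ k + 1 := by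
      have := mul_laguerreDeriv_succ k t
      calc _ = (((k : ℝ) + 1) * (laguerre (k + 1) t - laguerre k t)) ^ 2 := by ring
        _ = t * (t * laguerreDeriv (k + 1) t ^ 2) := by rw [← this]; ring
        _ ≤ _ := by linarith
    rw [le_div_iff₀ h2]
    by_contra! h5
    nlinarith
  have h0 : Tendsto (fun k => (laguerre k t - laguerre (k + 1) t) ^ 2) atTop (𝓝 0) :=
    squeeze_zero (fun _ => sq_nonneg _) hsq tendsto_one_div_add_atTop_nhds_zero_nat
  have := (Real.continuous_sqrt.tendsto 0).comp h0
  rw [Real.sqrt_zero] at this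
  refine (tendsto_zero_iff_abs_tendsto_zero _).2 (this.congr fun k => ?_)
  simp [Real.sqrt_sq_eq_abs]

/-! ### The backward orbit of 1 under I + V, and decay of both orbits under V -/

/-- The backward orbit of `1` under `I + V` with `V` the Volterra operator. -/
noncomputable def expLaguerre : ℕ → C(ℝ, ℝ)
  | 0 => 1
  | k + 1 => ⟨fun t => Real.exp (-t) * laguerre k t, by fun_prop⟩

theorem hasDerivAt_expLaguerre_succ (k : ℕ) (t : ℝ) :
    HasDerivAt (expLaguerre (k + 1))
      (Real.exp (-t) * laguerreDeriv k t - expLaguerre (k + 1) t) t := by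
  refine (((hasDerivAt_id t).neg.exp).mul (hasDerivAt_laguerre k t)).congr_deriv ?_
  simp [expLaguerre]
  ring

theorem expLaguerre_apply_zero (k : ℕ) : expLaguerre k 0 = 1 := by
  cases k <;> simp [expLaguerre, laguerre_apply_zero]

theorem expLaguerre_succ_add_volterra (k : ℕ) :
    expLaguerre (k + 1) + volterra (expLaguerre (k + 1)) = expLaguerre k := by
  have h : ∀ t, HasDerivAt (expLaguerre k) (Real.exp (-t) * laguerreDeriv k t) t := fun t => by
    cases k with
    | zero =>
      simp only [laguerreDeriv, mul_zero]
      exact hasDerivAt_const t (1 : ℝ)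
    | succ k =>
      refine (hasDerivAt_expLaguerre_succ k t).congr_deriv ?_
      simp [expLaguerre, laguerreDeriv]
      ring
  ext t
  have hd : ∀ s, HasDerivAt (fun s => expLaguerre (k + 1) s + volterra (expLaguerre (k + 1)) s -
      expLaguerre k s) 0 s := fun s =>
    (((hasDerivAt_expLaguerre_succ k s).add (hasDerivAt_volterra _ s)).sub (h s)).congr_deriv
      (by ring)
  exact sub_eq_zero.1 (eq_zero_of_hasDerivAt_zero hd
    (by simp [expLaguerre_apply_zero, volterra_zero]) t)

theorem abs_expLaguerre_le_one (k : ℕ) {t : ℝ} (ht : t ∈ Set.Icc (0 : ℝ) (1 / 2)) :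
    |expLaguerre k t| ≤ 1 := by
  cases k with
  | zero => simp [expLaguerre]
  | succ k =>
    simp only [expLaguerre, ContinuousMap.coe_mk, abs_mul, Real.abs_exp]
    exact mul_le_one₀ (Real.exp_le_one_iff.2 (by linarith [ht.1])) (abs_nonneg _)
      (abs_laguerre_le_one k ht)

/-- Since V L_k = L_k - L_{k+1}, each further power of V produces a difference of consecutive terms
of a null sequence. -/
theorem tendsto_volterra_pow_laguerre {t : ℝ} (ht : t ∈ Set.Icc (0 : ℝ) (1 / 2)) (n : ℕ) :
    Tendsto (fun k => (volterra ^ (n + 1)) (laguerre k) t) atTop (𝓝 0) := by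
  induction n with
  | zero =>
    refine (tendsto_laguerre_sub ht).congr fun k => ?_
    simp [laguerre_succ]
  | succ n ih =>
    have := ih.sub ((tendsto_add_atTop_iff_nat 1).2 ih)
    rw [sub_zero] at this
    refine this.congr fun k => ?_
    rw [laguerre_succ, map_sub, pow_succ volterra (n + 1), Module.End.mul_apply]
    simp

theorem tendsto_volterra_pow_expLaguerre {t : ℝ} (ht : t ∈ Set.Icc (0 : ℝ) (1 / 2)) (n : ℕ) :
    Tendsto (fun k => (volterra ^ (n + 1)) (expLaguerre k) t) atTop (𝓝 0) := by
  have hrec : ∀ k, volterra (expLaguerre (k + 1)) = expLaguerre k - expLaguerre (k + 1) := fun k =>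
    eq_sub_of_add_eq' (expLaguerre_succ_add_volterra k)
  induction n with
  | zero =>
    -- The shift by 2 makes both terms of the difference of the form e^{-t} L_j; the initial term 1
    -- is not.
    rw [← tendsto_add_atTop_iff_nat 2]
    have := (tendsto_laguerre_sub ht).const_mul (Real.exp (-t))
    rw [mul_zero] at this
    refine this.congr fun k => ?_
    rw [zero_add, pow_one, hrec (k + 1)]
    simp [expLaguerre]
    ring
  | succ n ih =>
    rw [← tendsto_add_atTop_iff_nat 1]
    have := ih.sub ((tendsto_add_atTop_iff_nat 1).2 ih)
    rw [sub_zero] at this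
    refine this.congr fun k => ?_
    rw [pow_succ volterra (n + 1), Module.End.mul_apply, hrec, map_sub]
    simp

/-! ### Abstract tools: backward orbits, power series, weight growth -/

/-- A sufficient condition for the Kitai Criterion in which the right inverse is not given: it
suffices to have backward orbits tending to zero inside a subspace on which `A` is injective. -/
theorem kitaiCriterion_of_backward_orbits {𝕜 X : Type*} [RCLike 𝕜] [NormedAddCommGroup X]
    [NormedSpace 𝕜 X] (A : X →L[𝕜] X) (H : Submodule 𝕜 X) (hH : ∀ x ∈ H, A x = 0 → x = 0)
    (hE : Dense {x : X | Tendsto (fun k : ℕ => (A ^ k) x) atTop (𝓝 0)})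
    (hF : Dense {y : X | ∃ u : ℕ → X, u 0 = y ∧ (∀ k, u k ∈ H) ∧ (∀ k, A (u (k + 1)) = u k) ∧
      Tendsto u atTop (𝓝 0)}) : KitaiCriterion A := by
  set F : Set X := {y : X | ∃ u : ℕ → X, u 0 = y ∧ (∀ k, u k ∈ H) ∧ (∀ k, A (u (k + 1)) = u k) ∧
      Tendsto u atTop (𝓝 0)}
  choose u hu0 huH huA hut using fun y : F => y.2
  have huF : ∀ (y : F) (m : ℕ), u y m ∈ F := fun y m =>
    ⟨fun k => u y (k + m), by simp, fun k => huH y _, fun k => by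
      beta_reduce; rw [add_right_comm]; exact huA y _, (tendsto_add_atTop_iff_nat m).2 (hut y)⟩
  let S : F → F := fun y => ⟨u y 1, huF y 1⟩
  have hinj : ∀ x ∈ H, ∀ y ∈ H, A x = A y → x = y := fun x hx y hy h =>
    sub_eq_zero.1 (hH _ (H.sub_mem hx hy) (by rw [map_sub, h, sub_self]))
  have hFH : ∀ y : F, (y : X) ∈ H := fun y => hu0 y ▸ huH y 0
  have hS : ∀ y : F, A (S y : X) = y := fun y => (huA y 0).trans (hu0 y)
  -- The orbit chosen for `S y` need not be the shifted orbit of `y` a priori; injectivity on `H`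
  -- forces the two to agree.
  have hSk : ∀ (y : F) (k : ℕ), ((S^[k] y : F) : X) = u y k := fun y k => by
    induction k with
    | zero => exact (hu0 y).symm
    | succ k ih =>
      rw [Function.iterate_succ_apply']
      exact hinj _ (hFH _) _ (huH y _) (by rw [hS, ih, huA])
  refine ⟨_, F, S, hE, hF, hS, fun y => ?_, fun x hx => hx⟩
  simpa only [hSk] using hut y

/-- A closed subspace that contains the values of a vector-valued power series at all small positive
reals contains its coefficients. -/
theorem mem_of_powerSeries_mem {𝕜 X : Type*} [RCLike 𝕜] [NormedAddCommGroup X]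
    [NormedSpace 𝕜 X] [CompleteSpace X] (W : Submodule 𝕜 X) (hW : IsClosed (W : Set X)) (b : ℕ → X)
    {δ K : ℝ} (hδ : 0 < δ) (hb : ∀ n, ‖b n‖ * δ ^ n ≤ K)
    (hmem : ∀ c ∈ Set.Ioo 0 δ, ∑' n, ((c : 𝕜) ^ n) • b n ∈ W) (n : ℕ) : b n ∈ W := by
  have hterm : ∀ m : ℕ, ∀ c ∈ Set.Ioo 0 (δ / 2), ∀ j,
      ‖((c : 𝕜) ^ j) • b (m + j)‖ ≤ K / δ ^ m * (1 / 2) ^ j := fun m c hc j => by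
    rw [norm_smul, norm_pow, RCLike.norm_ofReal, abs_of_pos hc.1]
    have h1 : c ^ j ≤ (δ / 2) ^ j := pow_le_pow_left₀ hc.1.le hc.2.le j
    have h2 : ‖b (m + j)‖ * δ ^ j ≤ K / δ ^ m := by
      rw [le_div_iff₀ (pow_pos hδ m)]
      calc _ = ‖b (m + j)‖ * δ ^ (m + j) := by ring
        _ ≤ K := hb _
    calc c ^ j * ‖b (m + j)‖ ≤ (δ / 2) ^ j * ‖b (m + j)‖ := by gcongr
      _ = (‖b (m + j)‖ * δ ^ j) * (1 / 2) ^ j := by rw [div_pow, one_div, inv_pow]; ring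
      _ ≤ _ := by gcongr
  have hgeom : ∀ m : ℕ, Summable fun j : ℕ => K / δ ^ m * (1 / 2 : ℝ) ^ j := fun m =>
    summable_geometric_two.mul_left _
  have hsum : ∀ m : ℕ, ∀ c ∈ Set.Ioo 0 (δ / 2), Summable fun j => ((c : 𝕜) ^ j) • b (m + j) :=
    fun m c hc => Summable.of_norm_bounded (hgeom m) (hterm m c hc)
  -- Subtract the coefficients already known to lie in `W`, then divide by c; letting c → 0+ below
  -- isolates the next one.
  have htail : ∀ m : ℕ, (∀ i < m, b i ∈ W) → ∀ c ∈ Set.Ioo 0 (δ / 2),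
      ∑' j, ((c : 𝕜) ^ j) • b (m + j) ∈ W := by
    intro m
    induction m with
    | zero =>
      intro _ c hc
      simpa using hmem c ⟨hc.1, by linarith [hc.2, hc.1]⟩
    | succ m ih =>
      intro hm c hc
      have h1 := ih (fun i hi => hm i (by omega)) c hc
      rw [(hsum m c hc).tsum_eq_zero_add] at h1
      have h2 : ∑' j, ((c : 𝕜) ^ (j + 1)) • b (m + (j + 1)) =
          (c : 𝕜) • ∑' j, ((c : 𝕜) ^ j) • b (m + 1 + j) := by
        rw [← (hsum (m + 1) c hc).tsum_const_smul]
        refine tsum_congr fun j => ?_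
        rw [smul_smul, pow_succ', add_right_comm, add_assoc]
      rw [h2, W.add_mem_iff_right (W.smul_mem _ (by simpa using hm m (by omega)))] at h1
      exact (W.smul_mem_iff (by simpa using hc.1.ne')).1 h1
  induction n using Nat.strong_induction_on with
  | _ n ih =>
    have hev : ∀ᶠ c : ℝ in 𝓝[>] 0, c ∈ Set.Ioo 0 (δ / 2) := Ioo_mem_nhdsGT (by positivity)
    have hlim : Tendsto (fun c : ℝ => ∑' j, ((c : 𝕜) ^ j) • b (n + j)) (𝓝[>] 0)
        (𝓝 (∑' j, ((0 : 𝕜) ^ j) • b (n + j))) := by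
      refine tendsto_tsum_of_dominated_convergence (hgeom n) (fun j => ?_)
        (hev.mono fun c hc => hterm n c hc)
      have : Continuous fun c : ℝ => ((c : 𝕜) ^ j) • b (n + j) := by fun_prop
      simpa using (this.tendsto 0).mono_left nhdsWithin_le_nhds
    have h0 : ∑' j, ((0 : 𝕜) ^ j) • b (n + j) = b n := by
      rw [tsum_eq_single 0 fun j hj => by simp [hj]]
      simp
    rw [h0] at hlim
    exact hW.mem_of_tendsto hlim (hev.mono fun c hc => htail n ih c hc)

theorem inv_prod_norm_le_of_liminf_pos {𝕜 : Type*} [RCLike 𝕜] {w : ℕ → 𝕜}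
    (hw0 : ∀ n, 1 ≤ n → w n ≠ 0)
    (hw : 0 < liminf (fun n : ℕ => ENNReal.ofReal
      (((n.factorial : ℝ) * ∏ j ∈ Finset.Icc 1 n, ‖w j‖) ^ (1 / (n : ℝ)))) atTop) :
    ∃ K C : ℝ, 0 < K ∧ 0 < C ∧ ∀ n : ℕ,
      (∏ j ∈ Finset.Icc 1 n, ‖w j‖)⁻¹ ≤ K * n.factorial * C ^ n := by
  obtain ⟨ε, hε0, hε⟩ := exists_between hw
  have hεtop : ε ≠ ⊤ := hε.ne_top
  have hr : 0 < ε.toReal := ENNReal.toReal_pos hε0.ne' hεtop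
  set r := ε.toReal
  have hpos : ∀ n, 0 < ∏ j ∈ Finset.Icc 1 n, ‖w j‖ := fun n =>
    Finset.prod_pos fun j hj => norm_pos_iff.2 (hw0 j (Finset.mem_Icc.1 hj).1)
  have hev : ∀ᶠ n : ℕ in atTop,
      (∏ j ∈ Finset.Icc 1 n, ‖w j‖)⁻¹ ≤ n.factorial * r⁻¹ ^ n := by
    filter_upwards [eventually_lt_of_lt_liminf hε, eventually_ge_atTop 1] with n hn hn1
    have hB : 0 < (n.factorial : ℝ) * ∏ j ∈ Finset.Icc 1 n, ‖w j‖ :=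
      mul_pos (by exact_mod_cast n.factorial_pos) (hpos n)
    have h1 : r ≤ ((n.factorial : ℝ) * ∏ j ∈ Finset.Icc 1 n, ‖w j‖) ^ (1 / (n : ℝ)) := by
      have := ENNReal.toReal_mono ENNReal.ofReal_ne_top hn.le
      rwa [ENNReal.toReal_ofReal (by positivity)] at this
    have h2 : r ^ n ≤ (n.factorial : ℝ) * ∏ j ∈ Finset.Icc 1 n, ‖w j‖ := by
      have := pow_le_pow_left₀ hr.le h1 n
      rwa [one_div, Real.rpow_inv_natCast_pow hB.le (by omega)] at this
    rw [inv_pow, inv_le_iff_one_le_mul₀ (hpos n)]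
    rw [mul_right_comm, ← div_eq_mul_inv, one_le_div (pow_pos hr n)]
    exact h2
  obtain ⟨N, hN⟩ := eventually_atTop.1 hev
  set q : ℕ → ℝ := fun n => (∏ j ∈ Finset.Icc 1 n, ‖w j‖)⁻¹ / (n.factorial * r⁻¹ ^ n) with hq
  have hden : ∀ n : ℕ, 0 < (n.factorial : ℝ) * r⁻¹ ^ n := fun n => by positivity
  have hq0 : ∀ n, 0 ≤ q n := fun n => div_nonneg (inv_nonneg.2 (hpos n).le) (hden n).le
  have hS : 0 ≤ ∑ n ∈ Finset.range N, q n := Finset.sum_nonneg fun n _ => hq0 n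
  -- The sum absorbs the finitely many indices where the asymptotic bound may fail; 1 covers the
  -- rest.
  refine ⟨1 + ∑ n ∈ Finset.range N, q n, r⁻¹, by positivity, by positivity, fun n => ?_⟩
  rw [mul_assoc, ← div_le_iff₀ (hden n)]
  change q n ≤ _
  by_cases h : n < N
  · have := Finset.single_le_sum (fun i _ => hq0 i) (Finset.mem_range.2 h)
    linarith
  · have : q n ≤ 1 := (div_le_one (hden n)).2 (hN n (by omega))
    linarith

/-! ### Transfer from Volterra orbits to orbits of I + T -/

section SeriesInBasis

variable {𝕜 X : Type*} [RCLike 𝕜] [NormedAddCommGroup X] [NormedSpace 𝕜 X] {f : ℕ → X} {K C c : ℝ}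

theorem norm_smul_le_of_factorial_growth (hC : 0 < C)
    (hf : ∀ n, ‖f n‖ ≤ K * n.factorial * C ^ n) (hc : 0 < c) (hcC : c * C ≤ 1 / 2) {a : ℕ → ℝ}
    (ha : ∀ n, |a n| ≤ c ^ (n + 1) / (n + 1).factorial) (n : ℕ) :
    ‖(a n : 𝕜) • f n‖ ≤ K * c * (1 / 2) ^ n := by
  have hn : 0 < ((n.factorial : ℕ) : ℝ) := by exact_mod_cast n.factorial_pos
  have hK : 0 ≤ K := by simpa using (norm_nonneg _).trans (hf 0)
  rw [norm_smul, RCLike.norm_ofReal]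
  have h1 : c ^ (n + 1) / ((n + 1).factorial : ℝ) ≤ c ^ (n + 1) / n.factorial := by
    gcongr
    omega
  calc |a n| * ‖f n‖ ≤ c ^ (n + 1) / n.factorial * (K * n.factorial * C ^ n) := by
        gcongr
        · exact (ha n).trans h1
        · exact hf n
    _ = K * c * (c * C) ^ n := by
        field_simp
        ring
    _ ≤ _ := by gcongr

variable [CompleteSpace X]

theorem summable_smul_of_factorial_growth (hC : 0 < C)
    (hf : ∀ n, ‖f n‖ ≤ K * n.factorial * C ^ n) (hc : 0 < c) (hcC : c * C ≤ 1 / 2) {a : ℕ → ℝ}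
    (ha : ∀ n, |a n| ≤ c ^ (n + 1) / (n + 1).factorial) : Summable fun n => (a n : 𝕜) • f n :=
  Summable.of_norm_bounded (summable_geometric_two.mul_left _)
    (norm_smul_le_of_factorial_growth hC hf hc hcC ha)

theorem tendsto_tsum_smul_zero (hC : 0 < C) (hf : ∀ n, ‖f n‖ ≤ K * n.factorial * C ^ n)
    (hc : 0 < c) (hcC : c * C ≤ 1 / 2) {a : ℕ → ℕ → ℝ}
    (ha : ∀ k n, |a k n| ≤ c ^ (n + 1) / (n + 1).factorial)
    (hlim : ∀ n, Tendsto (fun k => a k n) atTop (𝓝 0)) :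
    Tendsto (fun k => ∑' n, (a k n : 𝕜) • f n) atTop (𝓝 0) := by
  have := tendsto_tsum_of_dominated_convergence (𝓕 := atTop) (f := fun k n => (a k n : 𝕜) • f n)
    (g := fun _ => (0 : X)) (summable_geometric_two.mul_left (K * c)) (fun n => ?_)
    (Eventually.of_forall fun k => norm_smul_le_of_factorial_growth hC hf hc hcC (ha k))
  · simpa using this
  · have h1 : Tendsto (fun k => ((a k n : ℝ) : 𝕜)) atTop (𝓝 ((0 : ℝ) : 𝕜)) :=
      (RCLike.continuous_ofReal.tendsto 0).comp (hlim n)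
    simpa using h1.smul_const (f n)

theorem id_add_shift_tsum (T : X →L[𝕜] X) (hT0 : T (f 0) = 0) (hT : ∀ n, T (f (n + 1)) = f n)
    (hC : 0 < C) (hf : ∀ n, ‖f n‖ ≤ K * n.factorial * C ^ n) (hc : 0 < c) (hcC : c * C ≤ 1 / 2)
    {a b : ℕ → ℝ} (ha : ∀ n, |a n| ≤ c ^ (n + 1) / (n + 1).factorial)
    (hab : ∀ n, b n = a n + a (n + 1)) :
    (ContinuousLinearMap.id 𝕜 X + T) (∑' n, (a n : 𝕜) • f n) = ∑' n, (b n : 𝕜) • f n := by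
  have hs := summable_smul_of_factorial_growth (𝕜 := 𝕜) hC hf hc hcC ha
  have hTs : Summable fun n => (a (n + 1) : 𝕜) • f n := by
    have := (summable_nat_add_iff 1).2 (T.summable hs)
    simpa [hT] using this
  have h1 : T (∑' n, (a n : 𝕜) • f n) = ∑' n, (a (n + 1) : 𝕜) • f n := by
    rw [T.map_tsum hs, (T.summable hs).tsum_eq_zero_add]
    simp [hT, hT0]
  rw [add_apply, ContinuousLinearMap.id_apply, h1, ← hs.tsum_add hTs]
  refine tsum_congr fun n => ?_
  rw [hab, RCLike.ofReal_add, add_smul]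

/-- After division by c the series is a power series in c, so the closure of `W` contains its
coefficients, hence every `f n`. -/
theorem dense_of_mem_series (hC : 0 < C) (hf : ∀ n, ‖f n‖ ≤ K * n.factorial * C ^ n)
    (hdense : Dense (Submodule.span 𝕜 (Set.range f) : Set X)) {δ : ℝ} (hδ : 0 < δ)
    (hδC : δ * C ≤ 1 / 2) {σ : ℝ} (hσ : |σ| = 1) (W : Submodule 𝕜 X)
    (hW : ∀ c ∈ Set.Ioo 0 δ,
      ∑' n, ((σ ^ n * (c ^ (n + 1) / (n + 1).factorial) : ℝ) : 𝕜) • f n ∈ W) :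
    Dense (W : Set X) := by
  have hσ0 : σ ≠ 0 := by rintro rfl; simp at hσ
  set b : ℕ → X := fun n => ((σ ^ n / (n + 1).factorial : ℝ) : 𝕜) • f n with hb
  have hmem : ∀ n, b n ∈ W.topologicalClosure := by
    refine mem_of_powerSeries_mem (𝕜 := 𝕜) W.topologicalClosure
      W.isClosed_topologicalClosure b hδ (K := K) (fun n => ?_) fun c hc => ?_
    · have h := norm_smul_le_of_factorial_growth (𝕜 := 𝕜) hC hf hδ hδC
        (a := fun n => σ ^ n * (δ ^ (n + 1) / (n + 1).factorial)) (fun n => by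
          rw [abs_mul, abs_pow, hσ, one_pow, one_mul, abs_of_nonneg (by positivity)]) n
      have hK : 0 ≤ K := by simpa using (norm_nonneg _).trans (hf 0)
      have h2 : ((σ ^ n * (δ ^ (n + 1) / (n + 1).factorial) : ℝ) : 𝕜) • f n =
          ((δ ^ (n + 1) : ℝ) : 𝕜) • b n := by
        rw [hb, smul_smul, ← RCLike.ofReal_mul]
        congr 2
        ring
      rw [h2, norm_smul, RCLike.norm_ofReal, abs_of_pos (by positivity)] at h
      refine le_of_mul_le_mul_right ?_ hδ
      calc ‖b n‖ * δ ^ n * δ = δ ^ (n + 1) * ‖b n‖ := by ring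
        _ ≤ K * δ * (1 / 2) ^ n := h
        _ ≤ K * δ * 1 := by
          gcongr
          exact pow_le_one₀ (by norm_num) (by norm_num)
        _ = K * δ := mul_one _
    · have h1 := W.le_topologicalClosure (hW c hc)
      have hc0 : (c : 𝕜) ≠ 0 := by simpa using hc.1.ne'
      have h2 := W.topologicalClosure.smul_mem (c : 𝕜)⁻¹ h1
      rw [← tsum_const_smul''] at h2
      convert h2 using 2 with n
      ext n
      rw [hb, smul_smul, smul_smul]
      congr 1
      push_cast
      field_simp
      ring
  have hfm : ∀ n, f n ∈ W.topologicalClosure := fun n => by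
    refine (W.topologicalClosure.smul_mem_iff (?_ : ((σ ^ n / (n + 1).factorial : ℝ) : 𝕜) ≠ 0)).1
      (hmem n)
    rw [Ne, RCLike.ofReal_eq_zero]
    have := (n + 1).factorial_pos
    positivity
  have hle : Submodule.span 𝕜 (Set.range f) ≤ W.topologicalClosure :=
    Submodule.span_le.2 (by rintro _ ⟨n, rfl⟩; exact hfm n)
  have := hdense.mono (show _ ⊆ (W.topologicalClosure : Set X) from hle)
  rw [Submodule.topologicalClosure_coe] at this
  exact dense_closure.1 this

/-- If `T` is the unweighted backward shift with respect to a biorthogonal system `(f n, ψ n)` such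
that `‖f n‖` grows at most like `n! C ^ n`, then `I + T` satisfies the Kitai Criterion. -/
theorem kitaiCriterion_id_add_of_factorial_growth (T : X →L[𝕜] X) (hT0 : T (f 0) = 0)
    (hT : ∀ n, T (f (n + 1)) = f n) (hC : 0 < C) (hf : ∀ n, ‖f n‖ ≤ K * n.factorial * C ^ n)
    (hdense : Dense (Submodule.span 𝕜 (Set.range f) : Set X)) (ψ : ℕ → X →L[𝕜] 𝕜)
    (hψ : ∀ n m, ψ n (f m) = if m = n then 1 else 0) (hsep : ∀ x, (∀ n, ψ n x = 0) → x = 0) :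
    KitaiCriterion (ContinuousLinearMap.id 𝕜 X + T) := by
  set A := ContinuousLinearMap.id 𝕜 X + T with hA
  -- The first bound makes the series converge geometrically; the second keeps c where |L_k| ≤ 1.
  obtain ⟨δ, hδ, hδC, hδ2⟩ : ∃ δ : ℝ, 0 < δ ∧ δ * C ≤ 1 / 2 ∧ δ ≤ 1 / 2 := by
    refine ⟨min (1 / 2 / C) (1 / 2), by positivity, ?_, min_le_right _ _⟩
    rw [← le_div_iff₀ hC]
    exact min_le_left _ _
  have hψT : ∀ n x, ψ n (T x) = ψ (n + 1) x := fun n x => by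
    have : (ψ n).comp T = ψ (n + 1) := by
      refine ContinuousLinearMap.ext_on hdense ?_
      rintro _ ⟨m, rfl⟩
      cases m with
      | zero => simp [hT0, hψ]
      | succ m => simp [hT, hψ]
    rw [← this]; rfl
  let H : Submodule 𝕜 X :=
    { carrier := {x | Tendsto (fun n => ψ n x) atTop (𝓝 0)}
      add_mem' := fun {x y} hx hy => by simpa using Tendsto.add hx hy
      zero_mem' := by simp
      smul_mem' := fun r x hx => by simpa using Tendsto.const_mul r hx }
  let E : Submodule 𝕜 X :=
    { carrier := {x | Tendsto (fun k : ℕ => (A ^ k) x) atTop (𝓝 0)}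
      add_mem' := fun {x y} hx hy => by simpa using Tendsto.add hx hy
      zero_mem' := by simp
      smul_mem' := fun r x hx => by
        simpa only [Set.mem_ofPred_eq, map_smul, smul_zero] using Tendsto.const_smul hx r }
  let F : Submodule 𝕜 X :=
    { carrier := {y : X | ∃ u : ℕ → X, u 0 = y ∧ (∀ k, u k ∈ H) ∧ (∀ k, A (u (k + 1)) = u k) ∧
        Tendsto u atTop (𝓝 0)}
      add_mem' := by
        rintro x y ⟨u, rfl, huH, huA, hut⟩ ⟨v, rfl, hvH, hvA, hvt⟩
        exact ⟨u + v, rfl, fun k => H.add_mem (huH k) (hvH k),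
          fun k => by simp only [Pi.add_apply, map_add, huA, hvA], by
            rw [← add_zero (0 : X)]; exact hut.add hvt⟩
      zero_mem' := ⟨0, rfl, fun _ => H.zero_mem, fun _ => map_zero A, tendsto_const_nhds⟩
      smul_mem' := by
        rintro r x ⟨u, rfl, huH, huA, hut⟩
        exact ⟨r • u, rfl, fun k => H.smul_mem r (huH k),
          fun k => by simp only [Pi.smul_apply, map_smul, huA], by
            rw [← smul_zero r]; exact hut.const_smul r⟩ }
  refine kitaiCriterion_of_backward_orbits A H (fun x hx hAx => ?_) ?_ ?_
  -- The coordinates of a kernel vector have constant modulus, so they vanish if they tend to 0.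
  · have hstep : ∀ n, ψ (n + 1) x = -ψ n x := fun n => by
      have := congrArg (ψ n) hAx
      rw [hA, add_apply, ContinuousLinearMap.id_apply, map_add, hψT,
        map_zero] at this
      exact (neg_eq_of_add_eq_zero_right this).symm
    refine hsep x fun n => ?_
    have hconst : ∀ m, ‖ψ (m + n) x‖ = ‖ψ n x‖ := fun m => by
      induction m with
      | zero => simp
      | succ m ih => rw [add_right_comm, hstep, norm_neg, ih]
    have hlim : Tendsto (fun m => ‖ψ (m + n) x‖) atTop (𝓝 ‖(0 : 𝕜)‖) :=
      ((tendsto_add_atTop_iff_nat n).2 hx).norm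
    simp only [hconst, norm_zero] at hlim
    exact norm_eq_zero.1 (tendsto_nhds_unique tendsto_const_nhds hlim)
  · refine dense_of_mem_series hC hf hdense hδ hδC (σ := -1) (by simp) E fun c hc => ?_
    have hcC : c * C ≤ 1 / 2 := (mul_le_mul_of_nonneg_right hc.2.le hC.le).trans hδC
    have hc2 : c ∈ Set.Icc (0 : ℝ) (1 / 2) := ⟨hc.1.le, hc.2.le.trans hδ2⟩
    -- The alternating sign turns I + T into I - V.
    set a : ℕ → ℕ → ℝ := fun k n => (-1) ^ n * (volterra ^ (n + 1)) (laguerre k) c with ha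
    have hbd : ∀ k n, |a k n| ≤ c ^ (n + 1) / (n + 1).factorial := fun k n => by
      rw [ha, abs_mul, abs_pow, abs_neg, abs_one, one_pow, one_mul]
      exact abs_volterra_pow_le (fun t ht => abs_laguerre_le_one k ht) (n + 1) c hc2
    have horb : ∀ k : ℕ, (A ^ k) (∑' n, (a 0 n : 𝕜) • f n) = ∑' n, (a k n : 𝕜) • f n := fun k => by
      induction k with
      | zero => simp
      | succ k ih =>
        rw [pow_succ', mul_apply_eq_comp, ih]
        refine id_add_shift_tsum T hT0 hT hC hf hc.1 hcC (hbd k) fun n => ?_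
        simp only [ha]
        rw [laguerre_succ, map_sub, pow_succ volterra (n + 1), Module.End.mul_apply,
          ContinuousMap.sub_apply]
        ring
    have h0 : (fun n : ℕ => (((-1) ^ n * (c ^ (n + 1) / (n + 1).factorial) : ℝ) : 𝕜) • f n) =
        fun n => (a 0 n : 𝕜) • f n := by
      ext n
      simp only [ha, laguerre_zero, volterra_pow_one]
    rw [h0]
    change Tendsto _ _ _
    simp only [horb]
    refine tendsto_tsum_smul_zero hC hf hc.1 hcC hbd fun n => ?_
    simpa using (tendsto_volterra_pow_laguerre hc2 n).const_mul ((-1) ^ n)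
  · refine dense_of_mem_series hC hf hdense hδ hδC (σ := 1) (by simp) F fun c hc => ?_
    have hcC : c * C ≤ 1 / 2 := (mul_le_mul_of_nonneg_right hc.2.le hC.le).trans hδC
    have hc2 : c ∈ Set.Icc (0 : ℝ) (1 / 2) := ⟨hc.1.le, hc.2.le.trans hδ2⟩
    set a : ℕ → ℕ → ℝ := fun k n => (volterra ^ (n + 1)) (expLaguerre k) c with ha
    have hbd : ∀ k n, |a k n| ≤ c ^ (n + 1) / (n + 1).factorial := fun k n =>
      abs_volterra_pow_le (fun t ht => abs_expLaguerre_le_one k ht) (n + 1) c hc2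
    refine ⟨fun k => ∑' n, (a k n : 𝕜) • f n, ?_, fun k => ?_, fun k => ?_,
      tendsto_tsum_smul_zero hC hf hc.1 hcC hbd fun n => tendsto_volterra_pow_expLaguerre hc2 n⟩
    · refine tsum_congr fun n => ?_
      simp only [ha, expLaguerre, volterra_pow_one, one_pow, one_mul]
    · have hs := summable_smul_of_factorial_growth (𝕜 := 𝕜) hC hf hc.1 hcC (hbd k)
      have hcoord : ∀ n, ψ n (∑' m, (a k m : 𝕜) • f m) = (a k n : 𝕜) := fun n => by
        rw [(ψ n).map_tsum hs, tsum_eq_single n fun m hm => by simp [hψ, hm]]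
        simp [hψ]
      change Tendsto _ _ _
      simp only [hcoord]
      have h1 : Tendsto (a k) atTop (𝓝 0) := squeeze_zero_norm (hbd k)
        ((tendsto_add_atTop_iff_nat 1).2 (FloorSemiring.tendsto_pow_div_factorial_atTop c))
      simpa [Function.comp_def] using (RCLike.continuous_ofReal (K := 𝕜).tendsto 0).comp h1
    · refine id_add_shift_tsum T hT0 hT hC hf hc.1 hcC (hbd (k + 1)) fun n => ?_
      simp only [ha]
      rw [pow_succ volterra (n + 1), Module.End.mul_apply, ← ContinuousMap.add_apply, ← map_add,
        expLaguerre_succ_add_volterra]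

/-- Dividing `e n` by w_1 ⋯ w_n makes the shift unweighted and moves the weights into the growth of
the norms. -/
theorem kitaiCriterion_id_add_backwardWeightedShift {e : ℕ → X} {w : ℕ → 𝕜} {T : X →L[𝕜] X}
    (hT : IsBackwardWeightedShift e w T) (he : ∀ n, ‖e n‖ ≤ 1)
    (hdense : Dense (Submodule.span 𝕜 (Set.range e) : Set X)) (φ : ℕ → X →L[𝕜] 𝕜)
    (hφ : ∀ n m, φ n (e m) = if m = n then 1 else 0) (hsep : ∀ x, (∀ n, φ n x = 0) → x = 0)
    (hw : 0 < liminf (fun n : ℕ => ENNReal.ofReal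
      (((n.factorial : ℝ) * ∏ j ∈ Finset.Icc 1 n, ‖w j‖) ^ (1 / (n : ℝ)))) atTop) :
    KitaiCriterion (ContinuousLinearMap.id 𝕜 X + T) := by
  obtain ⟨K, C, -, hC, hKC⟩ := inv_prod_norm_le_of_liminf_pos hT.weight_ne_zero hw
  set v : ℕ → 𝕜 := fun n => ∏ j ∈ Finset.Icc 1 n, w j with hv
  have hv0 : ∀ n, v n ≠ 0 := fun n =>
    Finset.prod_ne_zero_iff.2 fun j hj => hT.weight_ne_zero j (Finset.mem_Icc.1 hj).1
  have hvs : ∀ n, v (n + 1) = v n * w (n + 1) := fun n =>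
    Finset.prod_Icc_succ_top (by omega) w
  refine kitaiCriterion_id_add_of_factorial_growth (f := fun n => (v n)⁻¹ • e n) (K := K) (C := C)
    T ?_ (fun n => ?_) hC (fun n => ?_) ?_ (fun n => v n • φ n) (fun n m => ?_) fun x hx => ?_
  · rw [map_smul, hT.map_zero, smul_zero]
  · rw [map_smul, hT.map_basis _ (by omega), smul_smul, hvs, Nat.add_sub_cancel, mul_inv, mul_assoc,
      inv_mul_cancel₀ (hT.weight_ne_zero _ (by omega)), mul_one]
  · rw [norm_smul, norm_inv, norm_prod]
    refine le_trans (mul_le_of_le_one_right ?_ (he n)) (hKC n)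
    positivity
  · refine hdense.mono (Submodule.span_le.2 ?_)
    rintro _ ⟨n, rfl⟩
    have h := (Submodule.span 𝕜 (Set.range fun n => (v n)⁻¹ • e n)).smul_mem (v n)
      (Submodule.subset_span ⟨n, rfl⟩)
    rwa [smul_inv_smul₀ (hv0 n)] at h
  · rw [smul_apply, map_smul, hφ]
    split_ifs with h
    · subst h
      simp [hv0]
    · simp
  · refine hsep x fun n => ?_
    have := hx n
    rw [smul_apply, smul_eq_zero] at this
    exact this.resolve_left (hv0 n)

end SeriesInBasis

/-! ### The spaces ℓ_p and c_0 -/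

theorem dense_span_lpBasis (𝕜 : Type*) [RCLike 𝕜] {p : ℝ≥0∞} [Fact (1 ≤ p)] (hp : p ≠ ∞) :
    Dense (Submodule.span 𝕜 (Set.range (lpBasis 𝕜 p)) : Set (lp (fun _ : ℕ => 𝕜) p)) := by
  intro x
  refine mem_closure_of_tendsto (lp.hasSum_single hp x) (Eventually.of_forall fun s => ?_)
  refine Submodule.sum_mem _ fun n _ => ?_
  have h : lp.single p n (x n) = x n • lpBasis 𝕜 p n := by
    rw [lpBasis, ← lp.single_smul, smul_eq_mul, mul_one]
  rw [h]
  exact Submodule.smul_mem _ _ (Submodule.subset_span ⟨n, rfl⟩)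

/-- The evaluation functionals on `c_0`. -/
noncomputable def c0Eval (𝕜 : Type*) [RCLike 𝕜] (n : ℕ) : C₀(ℕ, 𝕜) →L[𝕜] 𝕜 :=
  LinearMap.mkContinuous
    { toFun := fun x => x n
      map_add' := fun _ _ => rfl
      map_smul' := fun _ _ => rfl } 1 fun x => by
    rw [one_mul, ← ZeroAtInftyContinuousMap.norm_toBCF_eq_norm]
    exact x.toBCF.norm_coe_le_norm n

theorem c0Eval_apply {𝕜 : Type*} [RCLike 𝕜] (n : ℕ) (x : C₀(ℕ, 𝕜)) : c0Eval 𝕜 n x = x n := rfl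

theorem c0Basis_apply {𝕜 : Type*} [RCLike 𝕜] (n m : ℕ) :
    c0Basis 𝕜 m n = if m = n then 1 else 0 := by
  simp only [c0Basis, eq_comm (a := m)]
  exact Pi.single_apply m (1 : 𝕜) n

theorem c0_norm_le {𝕜 : Type*} [RCLike 𝕜] {x : C₀(ℕ, 𝕜)} {r : ℝ} (hr : 0 ≤ r)
    (h : ∀ n, ‖x n‖ ≤ r) : ‖x‖ ≤ r := by
  rw [← ZeroAtInftyContinuousMap.norm_toBCF_eq_norm]
  exact (BoundedContinuousFunction.norm_le hr).2 h

theorem dense_span_c0Basis (𝕜 : Type*) [RCLike 𝕜] :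
    Dense (Submodule.span 𝕜 (Set.range (c0Basis 𝕜)) : Set C₀(ℕ, 𝕜)) := by
  intro x
  rw [Metric.mem_closure_iff]
  intro ε hε
  have hx : Tendsto x atTop (𝓝 0) := by
    have := x.zero_at_infty'
    rwa [cocompact_eq_cofinite, Nat.cofinite_eq_atTop] at this
  obtain ⟨N, hN⟩ := Metric.tendsto_atTop.1 hx (ε / 2) (half_pos hε)
  refine ⟨∑ n ∈ Finset.range N, x n • c0Basis 𝕜 n, Submodule.sum_mem _ fun n _ =>
    Submodule.smul_mem _ _ (Submodule.subset_span ⟨n, rfl⟩), ?_⟩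
  rw [dist_eq_norm]
  refine (c0_norm_le (half_pos hε).le fun n => ?_).trans_lt (half_lt_self hε)
  rw [← c0Eval_apply, map_sub, map_sum]
  simp only [map_smul, c0Eval_apply, c0Basis_apply, smul_eq_mul, mul_ite, mul_one, mul_zero,
    Finset.sum_ite_eq', Finset.mem_range]
  split_ifs with h
  · simpa using (half_pos hε).le
  · simpa using (hN n (not_lt.1 h)).le

theorem theorem2 {𝕜 : Type*} [RCLike 𝕜] (w : ℕ → 𝕜)
    -- the lower limit is taken in `[0, ∞]`, as it may be infinite
    (hw : 0 < liminf (fun n : ℕ => ENNReal.ofReal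
      (((n.factorial : ℝ) * ∏ j ∈ Finset.Icc 1 n, ‖w j‖) ^ (1 / (n : ℝ)))) atTop) :
    (∀ (p : ℝ≥0∞) [Fact (1 ≤ p)], p ≠ ∞ →
      ∀ T : lp (fun _ : ℕ => 𝕜) p →L[𝕜] lp (fun _ : ℕ => 𝕜) p,
        IsBackwardWeightedShift (lpBasis 𝕜 p) w T →
          KitaiCriterion (ContinuousLinearMap.id 𝕜 (lp (fun _ : ℕ => 𝕜) p) + T)) ∧
    (∀ T : C₀(ℕ, 𝕜) →L[𝕜] C₀(ℕ, 𝕜),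
      IsBackwardWeightedShift (c0Basis 𝕜) w T →
        KitaiCriterion (ContinuousLinearMap.id 𝕜 C₀(ℕ, 𝕜) + T)) := by
  refine ⟨fun p _ hp T hT => ?_, fun T hT => ?_⟩
  · have hp0 : 0 < p := zero_lt_one.trans_le Fact.out
    refine kitaiCriterion_id_add_backwardWeightedShift hT (fun n => ?_) (dense_span_lpBasis 𝕜 hp)
      (fun n => lp.evalCLM 𝕜 (fun _ : ℕ => 𝕜) p n) (fun n m => ?_) (fun x hx => ?_) hw
    · rw [lpBasis, lp.norm_single hp0, norm_one]
    · change (lpBasis 𝕜 p m : ℕ → 𝕜) n = _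
      rw [lpBasis, lp.single_apply, Pi.single_apply]
      simp only [eq_comm]
    · ext n
      exact hx n
  · refine kitaiCriterion_id_add_backwardWeightedShift hT (fun n => ?_) (dense_span_c0Basis 𝕜)
      (c0Eval 𝕜) (fun n m => c0Basis_apply n m) (fun x hx => ?_) hw
    · refine c0_norm_le zero_le_one fun m => ?_
      rw [c0Basis_apply]
      split_ifs <;> simp
    · ext n
      exact hx n
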